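/- Let $k$ be a field of characteristic $p>0$, let $P$ be a finite poset, and let $D=J(P)$ be the set of its poset ideals, that is, of the subsets $I\subseteq P$ with $y\in I$ whenever $y\le x\in I$. Let $$R=\mathcal R_k[D]=k\Big[\,T\prod_{x\in I}X_x \;\Big|\; I\in J(P)\Big]\subseteq k[T,\,X_x\;(x\in P)]$$ be the Hibi ring of $D$, and let $\mathfrak m$ be its homogeneous maximal ideal, generated by the monomials $T\prod_{x\in I}X_x$, $I\in J(P)$. For a real number $t\ge 0$ the pair $(R,\mathfrak m^t)$ is called $F$-pure if for all large $q=p^e$ there is an element $d\in\mathfrak m^{\lceil t(q-1)\rceil}$ such that the $R$-linear map $R\to R^{1/q}$, $1\mapsto d^{1/q}$, splits; and $$\operatorname{fpt}(\mathfrak m)=\sup\{t\in\mathbb R_{\ge 0}\mid (R,\mathfrak m^t)\text{ is }F\text{-pure}\}.$$ Let $\overline P=P\cup\{-\infty,\infty\}$ be the poset obtained from $P$ by adding a least element $-\infty$ and a greatest element $\infty$, write $x\lessdot y$ if $y$ covers $x$ in $\overline P$, and let $\Sigma$ be the set of all functions $\psi:\overline P\to\mathbb R$ such that $\psi(\infty)=0$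 and $$0\le\psi(x)-\psi(y)\le 1\quad\text{whenever } x\lessdot y .$$ Then $$\operatorname{fpt}(\mathfrak m)=\max\{\psi(-\infty)\mid\psi\in\Sigma\},$$ and in particular the maximum exists. -/

import Mathlib

/-! ### `F`-purity of pairs and `F`-pure thresholds -/

section FPure

/-- The `R`-module `R^{1/q}`, `q = p ^ e`, for a ring `R` of characteristic `p`. The element `x^{1/q}`
is represented by `x : R`, and `r • x^{1/q} = (r ^ q * x)^{1/q}`; that is, this is `F^e_* R`. -/
def FrobRoot (R : Type*) (_p _e : ℕ) : Type _ := R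

instance (R : Type*) [CommRing R] (p e : ℕ) : AddCommGroup (FrobRoot R p e) :=
  inferInstanceAs (AddCommGroup R)

noncomputable instance (R : Type*) [CommRing R] (p e : ℕ) [Fact p.Prime] [CharP R p] :
    Module R (FrobRoot R p e) :=
  Module.compHom R (iterateFrobenius R p e)

/-- The element `d^{1/q}` of `R^{1/q}`, `q = p ^ e`. -/
def FrobRoot.root {R : Type*} (p e : ℕ) (d : R) : FrobRoot R p e := d

theorem FrobRoot.smul_root {R : Type*} [CommRing R] (p e : ℕ) [Fact p.Prime] [CharP R p]
    (r d : R) : r • FrobRoot.root p e d = FrobRoot.root p e (r ^ p ^ e * d) := rfl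

/-- The `R`-linear map `R → R^{1/q}`, `1 ↦ d^{1/q}`, splits. -/
def FrobRootSplits {R : Type*} [CommRing R] (p e : ℕ) [Fact p.Prime] [CharP R p] (d : R) : Prop :=
  ∃ φ : FrobRoot R p e →ₗ[R] R,
    φ ∘ₗ LinearMap.toSpanSingleton R (FrobRoot R p e) (FrobRoot.root p e d) = LinearMap.id

/-- The pair `(R, 𝔞 ^ t)` is `F`-pure: for all large `q = p ^ e` there is an element
`d ∈ 𝔞 ^ ⌈t (q - 1)⌉` such that `R → R^{1/q}`, `1 ↦ d^{1/q}`, splits. -/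
def IsFPurePair {R : Type*} [CommRing R] (p : ℕ) [Fact p.Prime] [CharP R p]
    (𝔞 : Ideal R) (t : ℝ) : Prop :=
  ∀ᶠ e : ℕ in Filter.atTop, ∃ d ∈ 𝔞 ^ ⌈t * ((p : ℝ) ^ e - 1)⌉₊, FrobRootSplits p e d

/-- The `F`-pure threshold of `𝔞`, the supremum of all `t ≥ 0` such that `(R, 𝔞 ^ t)` is `F`-pure.
The supremum is taken in the extended reals, so that no convention about empty or unbounded sets
of reals is used. -/
noncomputable def fPureThreshold {R : Type*} [CommRing R] (p : ℕ) [Fact p.Prime] [CharP R p]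
    (𝔞 : Ideal R) : EReal :=
  sSup {x : EReal | ∃ t : ℝ, 0 ≤ t ∧ IsFPurePair p 𝔞 t ∧ x = (t : EReal)}

end FPure

/-! ### Hibi rings -/

section Hibi

variable (k : Type*) [Field k] (P : Type*) [PartialOrder P] [Fintype P]

open Classical in
/-- The monomial `T * ∏_{x ∈ I} X_x` of a poset ideal (lower set) `I` of `P`. The variable `T` has
index `none` and the variable `X_x` has index `some x`. -/
noncomputable def hibiMonomial (I : LowerSet P) : MvPolynomial (Option P) k :=
  MvPolynomial.X none * ∏ x ∈ Finset.univ.filter (fun x : P => x ∈ I), MvPolynomial.X (some x)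

/-- The Hibi ring of the distributive lattice of poset ideals of `P`. -/
noncomputable def hibiRing : Subalgebra k (MvPolynomial (Option P) k) :=
  Algebra.adjoin k (Set.range (hibiMonomial k P))

instance (p : ℕ) [CharP k p] : CharP (hibiRing k P) p :=
  charP_of_injective_algebraMap (algebraMap k (hibiRing k P)).injective p

/-- The generator of the Hibi ring that belongs to the poset ideal `I`. -/
noncomputable def hibiGen (I : LowerSet P) : hibiRing k P :=
  ⟨hibiMonomial k P I, Algebra.subset_adjoin ⟨I, rfl⟩⟩

/-- The homogeneous maximal ideal `R₊` of the Hibi ring `R` (a standard graded `k`-algebra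
with the generators in degree one). -/
noncomputable def hibiMaxIdeal : Ideal (hibiRing k P) :=
  Ideal.span (Set.range (hibiGen k P))

/-- `R₊` consists of the elements of the Hibi ring without constant term. -/
theorem mem_hibiMaxIdeal_iff (f : hibiRing k P) :
    f ∈ hibiMaxIdeal k P ↔ MvPolynomial.constantCoeff (f : MvPolynomial (Option P) k) = 0 := by
  have hgen : ∀ g ∈ hibiMaxIdeal k P,
      MvPolynomial.constantCoeff (g : MvPolynomial (Option P) k) = 0 := by
    intro g hg
    have hle : hibiMaxIdeal k P ≤ RingHom.ker
        (MvPolynomial.constantCoeff.comp (hibiRing k P).val.toRingHom) := by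
      refine Ideal.span_le.2 ?_
      rintro _ ⟨I, rfl⟩
      simp [RingHom.mem_ker, hibiGen, hibiMonomial]
    exact hle hg
  have key : ∀ (g : MvPolynomial (Option P) k) (hg : g ∈ hibiRing k P),
      ∃ a : k, (⟨g, hg⟩ : hibiRing k P) - algebraMap k _ a ∈ hibiMaxIdeal k P := by
    intro g hg
    induction hg using Algebra.adjoin_induction with
    | mem x hx =>
      obtain ⟨I, rfl⟩ := hx
      refine ⟨0, ?_⟩
      rw [map_zero, sub_zero]
      exact Ideal.subset_span ⟨I, rfl⟩
    | algebraMap r =>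
      refine ⟨r, ?_⟩
      convert (hibiMaxIdeal k P).zero_mem
      exact sub_self _
    | add x y hx hy ihx ihy =>
      obtain ⟨a, ha⟩ := ihx
      obtain ⟨b, hb⟩ := ihy
      refine ⟨a + b, ?_⟩
      convert (hibiMaxIdeal k P).add_mem ha hb using 1
      rw [map_add, sub_add_sub_comm]
      rfl
    | mul x y hx hy ihx ihy =>
      obtain ⟨a, ha⟩ := ihx
      obtain ⟨b, hb⟩ := ihy
      refine ⟨a * b, ?_⟩
      have h := (hibiMaxIdeal k P).add_mem ((hibiMaxIdeal k P).mul_mem_right ⟨y, hy⟩ ha)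
        ((hibiMaxIdeal k P).mul_mem_left (algebraMap k _ a) hb)
      convert h using 1
      rw [map_mul, sub_mul, mul_sub, sub_add_sub_cancel]
      rfl
  refine ⟨hgen f, fun hf => ?_⟩
  obtain ⟨a, ha⟩ := key f f.2
  have h := hgen _ ha
  have ha0 : a = 0 := by
    have h2 : MvPolynomial.constantCoeff ((f : MvPolynomial (Option P) k) -
        MvPolynomial.C a) = 0 := h
    rw [map_sub, hf, MvPolynomial.constantCoeff_C] at h2
    simpa using h2
  rw [ha0, map_zero, sub_zero] at ha
  exact ha

/-- The set of real functions `ψ` on `P ∪ {-∞, ∞}` with `ψ ∞ = 0` and `0 ≤ ψ x - ψ y ≤ 1`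
whenever `y` covers `x`. Here `-∞` is `⊥` and `∞` is `⊤`. -/
def hibiSigma (P : Type*) [PartialOrder P] : Set (WithBot (WithTop P) → ℝ) :=
  {ψ | ψ ⊤ = 0 ∧ ∀ x y : WithBot (WithTop P), x ⋖ y → 0 ≤ ψ x - ψ y ∧ ψ x - ψ y ≤ 1}

end Hibi

/-! Monomials of `R` are the antitone functions `v` to `ℕ` on `P ∪ {-∞, ∞}` with `v ∞ = 0`, and `v
(-∞)` is the degree. Each cover `x ⋖ y` gives a facet value `v x - v y ≥ 0`. For `q = p ^ e`, a
monomial splits off in `R^{1/q}` exactly when all its facet values are at most `q - 1`.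

If they are, reading off the exponents `q w + v` is an `R`-linear splitting
(`frobRootSplits_monomial`). If one is at least `q`, `exists_smul_add_eq_of_le` gives `q w + v = q u
+ z` with `w` on that facet and `u` off it. Then `x^w φ(x^v) = x^u φ(x^z)` keeps `φ(x^v)` from
having a constant term, whereas `φ(d) = 1` forces one for some term of `d`
(`exists_of_frobRootSplits`).

So `F`-purity is a lattice point problem: dividing `v` by `q - 1` gives a point of `Σ`, and rounding
down `(q - 1) ψ` goes back, with a loss that is negligible for large `q`. Compactness of `Σ` gives
the maximum. -/

section HibiExponents

/-! ### Exponent vectors as functions on the extended poset -/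

variable {P : Type*}

/-- The function on `P ∪ {-∞, ∞}` given by an exponent vector: its value at `-∞` is the exponent
of `T`, and its value at `∞` is zero. -/
def hibiExt (a : Option P →₀ ℕ) : WithBot (WithTop P) → ℕ :=
  WithBot.recBotCoe (a none) (WithTop.recTopCoe 0 fun x => a (some x))

@[simp] theorem hibiExt_bot (a : Option P →₀ ℕ) : hibiExt a ⊥ = a none := rfl

@[simp] theorem hibiExt_top (a : Option P →₀ ℕ) : hibiExt a ⊤ = 0 := rfl

@[simp] theorem hibiExt_coe (a : Option P →₀ ℕ) (x : P) :
    hibiExt a ((x : WithTop P) : WithBot (WithTop P)) = a (some x) := rfl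

theorem hibiPoint_cases {q : WithBot (WithTop P) → Prop} (bot : q ⊥) (top : q ⊤)
    (coe : ∀ x : P, q ((x : WithTop P) : WithBot (WithTop P))) (z : WithBot (WithTop P)) : q z := by
  induction z using WithBot.recBotCoe with
  | bot => exact bot
  | coe z =>
    induction z using WithTop.recTopCoe with
    | top => exact top
    | coe x => exact coe x

theorem hibiExt_add (a b : Option P →₀ ℕ) (z : WithBot (WithTop P)) :
    hibiExt (a + b) z = hibiExt a z + hibiExt b z := by
  induction z using hibiPoint_cases <;> simp

theorem hibiExt_smul (n : ℕ) (a : Option P →₀ ℕ) (z : WithBot (WithTop P)) :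
    hibiExt (n • a) z = n * hibiExt a z := by
  induction z using hibiPoint_cases <;> simp

theorem hibiExt_zero (z : WithBot (WithTop P)) : hibiExt (0 : Option P →₀ ℕ) z = 0 := by
  induction z using hibiPoint_cases <;> simp

theorem le_of_hibiExt_le {a b : Option P →₀ ℕ} (h : ∀ z, hibiExt a z ≤ hibiExt b z) : a ≤ b := by
  intro o
  cases o with
  | none => exact h ⊥
  | some x => exact h ((x : WithTop P) : WithBot (WithTop P))

theorem hibiExt_injective : Function.Injective (hibiExt (P := P)) := fun _ _ h =>
  le_antisymm (le_of_hibiExt_le fun z => (congrFun h z).le)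
    (le_of_hibiExt_le fun z => (congrFun h z).ge)

theorem exists_hibiExt_eq [Finite P] (f : WithBot (WithTop P) → ℕ) (hf : f ⊤ = 0) :
    ∃ a : Option P →₀ ℕ, hibiExt a = f := by
  refine ⟨Finsupp.equivFunOnFinite.symm fun o =>
    o.elim (f ⊥) fun x => f ((x : WithTop P) : WithBot (WithTop P)), ?_⟩
  funext z
  induction z using hibiPoint_cases with
  | bot => simp
  | top => simp [hf]
  | coe x => simp

variable [PartialOrder P]

theorem antitone_of_covBy_le {α β : Type*} [PartialOrder α] [Finite α] [Preorder β] {f : α → β}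
    (h : ∀ x y, x ⋖ y → f y ≤ f x) : Antitone f := by
  classical
  cases nonempty_fintype α
  let _ := Fintype.toLocallyFiniteOrder (α := α)
  exact (antitone_iff_forall_covBy f).2 fun x y hxy => h x y hxy

variable [Finite P]

/-- If `q w + v` and `q u` differ by the exponent vector `z` of a monomial of the Hibi ring and
all facet values of `v` are less than `q`, then `w - u` lies in the cone of the Hibi ring. -/
theorem antitone_hibiExt_sub {q : ℕ} {u v w z : Option P →₀ ℕ}
    (hv : ∀ x y, x ⋖ y → hibiExt v x < hibiExt v y + q)
    (hz : Antitone (hibiExt z)) (h : q • w + v = q • u + z) :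
    Antitone fun x => (hibiExt w x : ℤ) - hibiExt u x := by
  refine antitone_of_covBy_le fun x y hxy => ?_
  have key : ∀ t, (q : ℤ) * hibiExt w t + hibiExt v t = q * hibiExt u t + hibiExt z t := by
    intro t
    have := congrFun (congrArg hibiExt h) t
    simp only [hibiExt_add, hibiExt_smul] at this
    exact_mod_cast this
  have h1 := key x
  have h2 := key y
  have h3 : (hibiExt v x : ℤ) < hibiExt v y + q := by exact_mod_cast hv x y hxy
  have h4 : (hibiExt z y : ℤ) ≤ hibiExt z x := by exact_mod_cast hz hxy.le
  show (hibiExt w y : ℤ) - hibiExt u y ≤ hibiExt w x - hibiExt u x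
  -- Facet values of `q (w - u) = z - v` exceed `-q`, so by integrality those of `w - u` are
  -- nonnegative.
  by_contra! hlt
  have h5 : (q : ℤ) * 1 ≤ q * ((hibiExt w y : ℤ) - hibiExt u y - (hibiExt w x - hibiExt u x)) :=
    mul_le_mul_of_nonneg_left (by omega) (by positivity)
  linarith

theorem le_of_smul_add_eq {q : ℕ} {u v w z : Option P →₀ ℕ}
    (hv : ∀ x y, x ⋖ y → hibiExt v x < hibiExt v y + q)
    (hz : Antitone (hibiExt z)) (h : q • w + v = q • u + z) : u ≤ w := by
  refine le_of_hibiExt_le fun x => ?_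
  have := antitone_hibiExt_sub hv hz h (le_top : x ≤ ⊤)
  simp only [hibiExt_top] at this
  omega

theorem antitone_hibiExt_of_smul_add {q : ℕ} {v w : Option P →₀ ℕ}
    (hv : ∀ x y, x ⋖ y → hibiExt v x < hibiExt v y + q)
    (hz : Antitone (hibiExt (q • w + v))) : Antitone (hibiExt w) := by
  have h := antitone_hibiExt_sub (u := 0) (w := w) hv hz (by simp)
  intro x y hxy
  have := h hxy
  simp only [hibiExt_zero] at this
  omega

/-- If the facet value of `v` at the cover `x ⋖ y` is at least `q`, then it can be lowered by `q`
after adding a vector that vanishes on this facet. -/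
theorem exists_smul_add_eq_of_le {q : ℕ} {v : Option P →₀ ℕ} (hv : Antitone (hibiExt v))
    {x y : WithBot (WithTop P)} (hxy : x ⋖ y) (h : hibiExt v y + q ≤ hibiExt v x) :
    ∃ u w z : Option P →₀ ℕ, Antitone (hibiExt u) ∧ Antitone (hibiExt w) ∧ Antitone (hibiExt z) ∧
      q • w + v = q • u + z ∧ hibiExt w x = hibiExt w y ∧ hibiExt u x = 1 ∧ hibiExt u y = 0 := by
  classical
  have hxt : ¬ ⊤ ≤ x := fun ht => hxy.lt.not_ge (le_top.trans ht)
  -- `w - u` is the indicator of `t ≤ y` minus that of `t = x`. The first indicator is dropped when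
  -- `y = ⊤`, since `w` must vanish at `⊤`.
  obtain ⟨u, hu⟩ := exists_hibiExt_eq (P := P) (fun t => if t ≤ x then 1 else 0) (if_neg hxt)
  obtain ⟨w, hw⟩ := exists_hibiExt_eq (P := P)
    (fun t => (if t < x then 1 else 0) + (if t ≤ y ∧ y ≠ ⊤ then 1 else 0)) (by
      have : ¬ (⊤ : WithBot (WithTop P)) < x := not_top_lt
      simp [this])
  have hzle : ∀ t, q * hibiExt u t ≤ q * hibiExt w t + hibiExt v t := by
    intro t
    simp only [hu, hw]
    by_cases h1 : t < x
    · rw [if_pos h1.le, if_pos h1, mul_add]; omega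
    · by_cases h2 : t ≤ x
      · obtain rfl : t = x := (lt_or_eq_of_le h2).resolve_left h1
        rw [if_pos h2]; omega
      · simp [h2]
  obtain ⟨z, hz⟩ := exists_hibiExt_eq (P := P)
    (fun t => q * hibiExt w t + hibiExt v t - q * hibiExt u t) (by simp)
  refine ⟨u, w, z, ?_, ?_, ?_, ?_, ?_, ?_, ?_⟩
  · rw [hu]
    intro a b hab
    dsimp only
    split_ifs with h1 h2 <;> first | omega | exact absurd (hab.trans h1) h2
  · rw [hw]
    intro a b hab
    have h1 : b < x → a < x := hab.trans_lt
    have h2 : b ≤ y → a ≤ y := hab.trans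
    dsimp only
    split_ifs <;> first | omega | tauto
  · rw [hz]
    intro a b hab
    have ha := hzle a
    have hb := hzle b
    have hvab := hv hab
    dsimp only
    suffices q * hibiExt w b + hibiExt v b + q * hibiExt u a ≤
        q * hibiExt w a + hibiExt v a + q * hibiExt u b by omega
    clear ha hb hzle hz
    simp only [hu, hw]
    by_cases hax : a ≤ x
    · by_cases hbx : b ≤ x
      · have h1 : b < x → a < x := hab.trans_lt
        have h2 : b ≤ y := hbx.trans hxy.le
        have h3 : a ≤ y := hax.trans hxy.le
        rw [if_pos hax, if_pos hbx]
        simp only [h2, h3, true_and]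
        by_cases h4 : b < x
        · simp only [h4, h1 h4, if_true]; omega
        · have : q * ((if b < x then 1 else 0) + if y ≠ ⊤ then 1 else 0) ≤
            q * ((if a < x then 1 else 0) + if y ≠ ⊤ then 1 else 0) := by
            rw [if_neg h4]; gcongr; omega
          omega
      · have hbx' : ¬ b < x := fun h => hbx h.le
        rw [if_pos hax, if_neg hbx, if_neg hbx']
        have h3 : a ≤ y := hax.trans hxy.le
        by_cases h1 : a < x
        · rw [if_pos h1]
          have : q * (0 + if b ≤ y ∧ y ≠ ⊤ then 1 else 0) ≤
            q * (if a ≤ y ∧ y ≠ ⊤ then 1 else 0) := by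
            gcongr
            split_ifs <;> first | omega | tauto
          rw [mul_add q 1]
          omega
        · obtain rfl : a = x := (lt_or_eq_of_le hax).resolve_left h1
          rw [if_neg h1]
          -- Only from `x` to `y` does `w - u` increase, by one; the drop of `v` by at least `q`
          -- compensates.
          by_cases hby : b = y
          · subst hby
            simp only [le_refl, h3]; omega
          · have hab' : a < b := lt_of_le_of_ne hab fun h => hbx h.ge
            have hnb : ¬ b ≤ y := fun hb => hxy.2 hab' (lt_of_le_of_ne hb hby)
            have hyt : y ≠ ⊤ := fun ht => hnb (ht ▸ le_top)
            simp only [hnb, h3, hyt, ne_eq, not_false_eq_true, and_self, false_and, if_true,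
              if_false]
            omega
    · have hbx : ¬ b ≤ x := fun h => hax (hab.trans h)
      have h2 : b ≤ y → a ≤ y := hab.trans
      rw [if_neg hax, if_neg hbx, if_neg fun h => hax (le_of_lt h),
        if_neg fun h => hbx (le_of_lt h)]
      have : q * (0 + if b ≤ y ∧ y ≠ ⊤ then 1 else 0) ≤
          q * (0 + if a ≤ y ∧ y ≠ ⊤ then 1 else 0) := by
        gcongr
        split_ifs <;> first | omega | tauto
      omega
  · refine hibiExt_injective (funext fun t => ?_)
    have := hzle t
    simp only [hibiExt_add, hibiExt_smul, hz]
    omega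
  · simp [hw, hxy.le, hxy.lt.not_gt]
  · simp [hu]
  · simp [hu, hxy.lt.not_ge]

end HibiExponents

/-! ### Monomial basis of the Hibi ring and powers of the maximal ideal -/

section HibiRing

variable {k : Type*} [Field k] {P : Type*} [PartialOrder P] [Fintype P]

open MvPolynomial

theorem exists_hibiMonomial_eq (I : LowerSet P) :
    ∃ a : Option P →₀ ℕ, Antitone (hibiExt a) ∧ hibiMonomial k P I = monomial a 1 ∧
      a none = 1 ∧ (∀ x ∈ I, a (some x) = 1) ∧ ∀ x ∉ I, a (some x) = 0 := by
  classical
  refine ⟨Finsupp.equivFunOnFinite.symm fun o => o.elim 1 fun x => if x ∈ I then 1 else 0,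
    ?_, ?_, ?_, ?_, ?_⟩
  · intro s t hst
    induction s using hibiPoint_cases with
    | bot =>
      induction t using hibiPoint_cases with
      | bot => simp
      | top => simp
      | coe x => simp only [hibiExt_coe, hibiExt_bot, Finsupp.coe_equivFunOnFinite_symm,
          Option.elim_some, Option.elim_none]; split_ifs <;> simp
    | top => rw [top_le_iff.1 hst]
    | coe x =>
      induction t using hibiPoint_cases with
      | bot => simp at hst
      | top => simp
      | coe y =>
        have hxy : x ≤ y := by simpa using hst
        have := I.lower hxy
        simp only [hibiExt_coe, Finsupp.coe_equivFunOnFinite_symm, Option.elim_some]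
        split_ifs with h1 h2 <;> first | omega | exact absurd (this h1) h2
  · rw [monomial_eq, Finsupp.prod_fintype _ _ (by simp), Fintype.prod_option, hibiMonomial]
    simp [Finset.prod_filter, pow_ite]
  · simp
  · intro x hx; simp [hx]
  · intro x hx; simp [hx]

theorem antitone_of_mem_hibiRing {f : MvPolynomial (Option P) k} (hf : f ∈ hibiRing k P)
    {a : Option P →₀ ℕ} (ha : coeff a f ≠ 0) : Antitone (hibiExt a) := by
  classical
  induction hf using Algebra.adjoin_induction generalizing a with
  | mem x hx =>
    obtain ⟨I, rfl⟩ := hx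
    obtain ⟨b, hb, h, -⟩ := exists_hibiMonomial_eq (k := k) I
    rw [h, coeff_monomial] at ha
    obtain rfl : b = a := by by_contra hne; simp [hne] at ha
    exact hb
  | algebraMap r =>
    rw [algebraMap_eq, coeff_C] at ha
    obtain rfl : 0 = a := by by_contra hne; simp [hne] at ha
    intro x y _
    simp [hibiExt_zero]
  | add x y _ _ ihx ihy =>
    by_cases hx : coeff a x = 0
    · exact ihy (by simpa [hx] using ha)
    · exact ihx hx
  | mul x y _ _ ihx ihy =>
    rw [coeff_mul] at ha
    obtain ⟨⟨b, c⟩, hbc, hne⟩ := Finset.exists_ne_zero_of_sum_ne_zero ha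
    rw [Finset.HasAntidiagonal.mem_antidiagonal] at hbc
    subst hbc
    intro s t hst
    rw [hibiExt_add, hibiExt_add]
    exact add_le_add (ihx (left_ne_zero_of_mul hne) hst) (ihy (right_ne_zero_of_mul hne) hst)

/-- The support of `a` is a poset ideal; dividing by its generator replaces `a` by the truncation of
`a - 1` at zero, again antitone and of degree one less. -/
theorem exists_monomial_mem_pow (n : ℕ) (a : Option P →₀ ℕ) (ha : Antitone (hibiExt a))
    (hn : a none = n) :
    ∃ h : monomial a (1 : k) ∈ hibiRing k P,
      (⟨monomial a 1, h⟩ : hibiRing k P) ∈ hibiMaxIdeal k P ^ n := by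
  induction n generalizing a with
  | zero =>
    obtain rfl : a = 0 := by
      refine le_antisymm (le_of_hibiExt_le fun z => ?_) zero_le
      rw [hibiExt_zero, ← hn]
      exact ha bot_le
    exact ⟨one_mem _, by simp⟩
  | succ n ih =>
    let I : LowerSet P := ⟨{x | 0 < a (some x)}, fun x y hyx hx => by
      have : a (some x) ≤ a (some y) := ha (a := ((y : WithTop P) : WithBot (WithTop P)))
        (b := ((x : WithTop P) : WithBot (WithTop P))) (by simpa using hyx)
      exact lt_of_lt_of_le hx this⟩
    have hI : ∀ x, x ∈ I ↔ 0 < a (some x) := fun x => Iff.rfl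
    obtain ⟨b, -, hbm, hb0, hb1, hb2⟩ := exists_hibiMonomial_eq (k := k) I
    have hba : ∀ z, hibiExt b z = min 1 (hibiExt a z) := by
      intro z
      induction z using hibiPoint_cases with
      | bot => simp [hb0, hn]
      | top => simp
      | coe x =>
        simp only [hibiExt_coe]
        by_cases hx : x ∈ I
        · have := (hI x).1 hx
          rw [hb1 x hx]; omega
        · have := mt (hI x).2 hx
          rw [hb2 x hx]; omega
    have hle : b ≤ a := le_of_hibiExt_le fun z => by rw [hba]; omega
    obtain ⟨c, rfl⟩ := exists_add_of_le hle
    have hc : Antitone (hibiExt c) := by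
      intro s t hst
      have h1 := ha hst
      have h2 := hba s
      have h3 := hba t
      simp only [hibiExt_add] at h1 h2 h3
      omega
    obtain ⟨h, hmem⟩ := ih c hc (by simp only [Finsupp.add_apply, hb0] at hn; omega)
    have heq : (monomial (b + c) (1 : k)) = hibiMonomial k P I * monomial c 1 := by
      rw [hbm, monomial_mul, one_mul]
    refine ⟨heq ▸ mul_mem (hibiGen k P I).2 h, ?_⟩
    have hprod : (⟨monomial (b + c) 1, heq ▸ mul_mem (hibiGen k P I).2 h⟩ : hibiRing k P) =
        hibiGen k P I * ⟨monomial c 1, h⟩ := Subtype.ext heq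
    rw [pow_succ', hprod]
    exact Ideal.mul_mem_mul (Ideal.subset_span ⟨I, rfl⟩) hmem

theorem monomial_mem_hibiRing {a : Option P →₀ ℕ} (ha : Antitone (hibiExt a)) (c : k) :
    monomial a c ∈ hibiRing k P := by
  have := Subalgebra.smul_mem _ (exists_monomial_mem_pow (k := k) _ a ha rfl).1 c
  rwa [smul_monomial, smul_eq_mul, mul_one] at this

theorem mem_hibiRing_iff {f : MvPolynomial (Option P) k} :
    f ∈ hibiRing k P ↔ ∀ a, coeff a f ≠ 0 → Antitone (hibiExt a) := by
  refine ⟨fun hf a ha => antitone_of_mem_hibiRing hf ha, fun h => ?_⟩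
  rw [f.as_sum]
  exact sum_mem fun a ha => monomial_mem_hibiRing (h a (mem_support_iff.1 ha)) _

/-- In the polynomial ring every generator is divisible by `T`. -/
theorem le_of_mem_hibiMaxIdeal_pow {n : ℕ} {f : hibiRing k P} (hf : f ∈ hibiMaxIdeal k P ^ n)
    {a : Option P →₀ ℕ} (ha : coeff a (f : MvPolynomial (Option P) k) ≠ 0) : n ≤ a none := by
  classical
  have hle : (hibiMaxIdeal k P).map (hibiRing k P).val ≤
      Ideal.span {(X none : MvPolynomial (Option P) k)} := by
    rw [hibiMaxIdeal, Ideal.map_span, Ideal.span_le]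
    rintro _ ⟨_, ⟨I, rfl⟩, rfl⟩
    exact Ideal.mem_span_singleton.2 ⟨_, rfl⟩
  have h := Ideal.mem_map_of_mem (hibiRing k P).val hf
  rw [Ideal.map_pow] at h
  have h' := Ideal.pow_right_mono hle n h
  rw [Ideal.span_singleton_pow, Ideal.mem_span_singleton] at h'
  obtain ⟨g, hg⟩ := h'
  change (f : MvPolynomial (Option P) k) = _ at hg
  rw [hg, X_pow_eq_monomial, coeff_monomial_mul'] at ha
  by_contra hlt
  refine ha (if_neg fun hsub => hlt ?_)
  simpa using hsub none

end HibiRing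

/-! ### Which monomials split off -/

section Splitting

variable {k : Type*} [Field k] {P : Type*} [PartialOrder P] [Fintype P]

open MvPolynomial

/-- The inclusion `k → k^{1/q}` of a field splits. -/
theorem exists_frobenius_splitting (k : Type*) [Field k] (p e : ℕ) [Fact p.Prime] [CharP k p] :
    ∃ l : k →+ k, l 1 = 1 ∧ ∀ r c, l (r ^ p ^ e * c) = r * l c := by
  have hp : p ^ e ≠ 0 := pow_ne_zero _ (Fact.out : p.Prime).ne_zero
  obtain ⟨g, hg⟩ := LinearMap.exists_leftInverse_of_injective
    (LinearMap.toSpanSingleton k (FrobRoot k p e) (FrobRoot.root p e 1)) (by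
      refine LinearMap.ker_eq_bot'.2 fun r hr => ?_
      have hr' : r ^ p ^ e * 1 = 0 := hr
      rw [mul_one] at hr'
      exact pow_eq_zero_iff hp |>.1 hr')
  refine ⟨⟨⟨fun c => g (FrobRoot.root p e c), g.map_zero⟩, fun a b => g.map_add _ _⟩, ?_, ?_⟩
  · have h := LinearMap.congr_fun hg 1
    rw [LinearMap.comp_apply, LinearMap.toSpanSingleton_apply, one_smul] at h
    exact h
  · intro r c
    have h := g.map_smul r (FrobRoot.root p e c)
    rw [FrobRoot.smul_root] at h
    exact h

/-- The additive map sending the monomial `c x ^ (q w + v)` to `l c x ^ w`, and the other monomials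
to zero. -/
noncomputable def monomialRoot {σ : Type*} (l : k →+ k) (q : ℕ) (hq : q ≠ 0) (v : σ →₀ ℕ) :
    MvPolynomial σ k →+ MvPolynomial σ k where
  toFun f := .ofCoeff <| (Finsupp.comapDomain (fun w : σ →₀ ℕ => q • w + v)
    (AddMonoidAlgebra.coeff f)
    (fun _ _ _ _ h => by
      refine Finsupp.ext fun i => ?_
      have := DFunLike.congr_fun h i
      simpa [hq] using this)).mapRange l l.map_zero
  map_zero' := MvPolynomial.ext _ _ fun _ => l.map_zero
  map_add' f g := MvPolynomial.ext _ _ fun w =>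
    (congrArg l (coeff_add (q • w + v) f g)).trans (l.map_add _ _)

theorem coeff_monomialRoot {σ : Type*} (l : k →+ k) (q : ℕ) (hq : q ≠ 0) (v w : σ →₀ ℕ)
    (f : MvPolynomial σ k) : coeff w (monomialRoot l q hq v f) = l (coeff (q • w + v) f) := rfl

/-- A monomial of the Hibi ring all of whose facet values are less than `q` splits off. -/
theorem frobRootSplits_monomial (p e : ℕ) [Fact p.Prime] [CharP k p] {v : Option P →₀ ℕ}
    (hva : Antitone (hibiExt v)) (hv : ∀ x y, x ⋖ y → hibiExt v x < hibiExt v y + p ^ e) :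
    FrobRootSplits p e (⟨monomial v 1, monomial_mem_hibiRing hva 1⟩ : hibiRing k P) := by
  classical
  obtain ⟨l, hl1, hl⟩ := exists_frobenius_splitting k p e
  have hp : p ^ e ≠ 0 := pow_ne_zero _ (Fact.out : p.Prime).ne_zero
  have hmem : ∀ f ∈ hibiRing k P, monomialRoot l (p ^ e) hp v f ∈ hibiRing k P := by
    intro f hf
    refine mem_hibiRing_iff.2 fun w hw => ?_
    rw [coeff_monomialRoot] at hw
    refine antitone_hibiExt_of_smul_add hv (mem_hibiRing_iff.1 hf _ fun h => hw ?_)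
    rw [h, map_zero]
  have hmul : ∀ g f, f ∈ hibiRing k P → monomialRoot l (p ^ e) hp v (g ^ p ^ e * f) =
      g * monomialRoot l (p ^ e) hp v f := by
    intro g f hf
    induction g using MvPolynomial.induction_on' with
    | add g h ihg ihh =>
      rw [add_pow_char_pow, add_mul, map_add, ihg, ihh, add_mul]
    | monomial u c =>
      ext w
      rw [coeff_monomialRoot, monomial_pow, coeff_monomial_mul', coeff_monomial_mul',
        coeff_monomialRoot]
      by_cases huw : u ≤ w
      · obtain ⟨z, rfl⟩ := exists_add_of_le huw
        have h1 : p ^ e • (u + z) + v = p ^ e • u + (p ^ e • z + v) := by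
          rw [smul_add, add_assoc]
        rw [if_pos huw, h1, if_pos (self_le_add_right _ _), add_tsub_cancel_left,
          add_tsub_cancel_left, hl]
      · rw [if_neg huw]
        split_ifs with h
        · obtain ⟨z, hz⟩ := exists_add_of_le h
          rw [hz, add_tsub_cancel_left]
          have : coeff z f = 0 := by
            by_contra hne
            -- For `u ≰ w`, a term of `f` contributing to exponent `q w + v` would put `w - u` in
            -- the cone.
            exact huw (le_of_smul_add_eq hv (mem_hibiRing_iff.1 hf _ hne) hz)
          rw [this, mul_zero, map_zero]
        · exact map_zero l
  refine ⟨⟨⟨fun f => ⟨monomialRoot l (p ^ e) hp v (f : hibiRing k P).1, hmem _ f.2⟩, ?_⟩, ?_⟩, ?_⟩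
  · intro f g
    exact Subtype.ext (map_add (monomialRoot l (p ^ e) hp v) f.1 g.1)
  · intro r f
    exact Subtype.ext (hmul r.1 f.1 f.2)
  · refine LinearMap.ext_ring ?_
    rw [LinearMap.comp_apply, LinearMap.toSpanSingleton_apply, one_smul]
    refine Subtype.ext ?_
    change monomialRoot l (p ^ e) hp v (monomial v 1) = 1
    ext w
    rw [coeff_monomialRoot, coeff_monomial, coeff_one]
    by_cases hw : 0 = w
    · subst hw; simp [hl1]
    · have : v ≠ p ^ e • w + v := fun h => hw (by
        have h2 : p ^ e • w = 0 := by simpa using h.symm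
        refine (Finsupp.ext fun i => ?_)
        have := DFunLike.congr_fun h2 i
        exact ((Nat.mul_eq_zero.1 this).resolve_left hp).symm)
      simp [hw, this]

/-- If `d ∈ 𝔪 ^ s` splits off, then some exponent vector of `d` has degree at least `s` and all
its facet values are less than `q`. -/
theorem exists_of_frobRootSplits {p e s : ℕ} [Fact p.Prime] [CharP k p] {d : hibiRing k P}
    (hd : d ∈ hibiMaxIdeal k P ^ s) (h : FrobRootSplits p e d) :
    ∃ v : Option P →₀ ℕ, Antitone (hibiExt v) ∧ s ≤ v none ∧
      ∀ x y, x ⋖ y → hibiExt v x < hibiExt v y + p ^ e := by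
  classical
  obtain ⟨φ, hφ⟩ := h
  have hφ1 : φ (FrobRoot.root p e d) = 1 := by
    have h := LinearMap.congr_fun hφ 1
    rw [LinearMap.comp_apply, LinearMap.toSpanSingleton_apply, one_smul] at h
    exact h
  have hφmul : ∀ r f : hibiRing k P,
      φ (FrobRoot.root p e (r ^ p ^ e * f)) = r * φ (FrobRoot.root p e f) := by
    intro r f
    rw [← FrobRoot.smul_root, map_smul, smul_eq_mul]
  let L : hibiRing k P →+ hibiRing k P :=
    ⟨⟨fun f => φ (FrobRoot.root p e f), φ.map_zero⟩, fun a b => φ.map_add _ _⟩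
  have hant : ∀ a ∈ d.1.support, Antitone (hibiExt a) := fun a ha =>
    mem_hibiRing_iff.1 d.2 a (mem_support_iff.1 ha)
  have hsum : d = ∑ a ∈ d.1.support.attach,
      (⟨monomial a.1 (coeff a.1 d.1), monomial_mem_hibiRing (hant a.1 a.2) _⟩ : hibiRing k P) := by
    refine Subtype.ext ?_
    rw [AddSubmonoidClass.coe_finsetSum, Finset.sum_attach _ fun a => monomial a (coeff a d.1)]
    exact d.1.as_sum
  -- The constant term of `φ(d) = 1` must come from a single term of `d`.
  obtain ⟨a, -, ha⟩ : ∃ a ∈ d.1.support.attach, constantCoeff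
      (L ⟨monomial a.1 (coeff a.1 d.1), monomial_mem_hibiRing (hant a.1 a.2) _⟩).1 ≠ 0 := by
    refine Finset.exists_ne_zero_of_sum_ne_zero ?_
    have h1 : constantCoeff (L d).1 = 1 := by
      change constantCoeff (φ (FrobRoot.root p e d)).1 = 1
      rw [hφ1]
      exact map_one _
    rw [hsum, map_sum, AddSubmonoidClass.coe_finsetSum, map_sum] at h1
    rw [h1]
    exact one_ne_zero
  refine ⟨a.1, hant a.1 a.2, le_of_mem_hibiMaxIdeal_pow hd (mem_support_iff.1 a.2), ?_⟩
  intro x y hxy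
  by_contra! hle
  obtain ⟨u, w, z, hu, hw, hz, heq, hwxy, hux, huy⟩ :=
    exists_smul_add_eq_of_le (hant a.1 a.2) hxy hle
  have hprod : (⟨monomial w 1, monomial_mem_hibiRing hw 1⟩ : hibiRing k P) ^ p ^ e *
      ⟨monomial a.1 (coeff a.1 d.1), monomial_mem_hibiRing (hant a.1 a.2) _⟩ =
      (⟨monomial u 1, monomial_mem_hibiRing hu 1⟩ : hibiRing k P) ^ p ^ e *
      ⟨monomial z (coeff a.1 d.1), monomial_mem_hibiRing hz _⟩ := by
    refine Subtype.ext ?_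
    change (monomial w (1 : k)) ^ p ^ e * monomial a.1 (coeff a.1 d.1) =
      (monomial u (1 : k)) ^ p ^ e * monomial z (coeff a.1 d.1)
    rw [monomial_pow, monomial_pow, monomial_mul, monomial_mul, heq]
  have h2 := congrArg (fun f : hibiRing k P => coeff w (φ (FrobRoot.root p e f)).1) hprod
  simp only [hφmul] at h2
  change coeff w (monomial w (1 : k) * _) = coeff w (monomial u (1 : k) * _) at h2
  rw [coeff_monomial_mul', coeff_monomial_mul', if_pos le_rfl, tsub_self, one_mul, one_mul] at h2
  change constantCoeff _ = _ at h2
  split_ifs at h2 with huw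
  · obtain ⟨b, rfl⟩ := exists_add_of_le huw
    rw [add_tsub_cancel_left] at h2
    -- Here `b = w - u` has facet value `-1` at `x ⋖ y`, so it cannot be an exponent in `R`.
    have hb := mem_hibiRing_iff.1 (Subtype.property _) b fun h0 => ha (h2.trans h0)
    have := hb hxy.le
    rw [hibiExt_add, hibiExt_add] at hwxy
    omega
  · exact ha h2

end Splitting

/-! ### Comparison with the polytope -/

section Threshold

theorem antitone_of_mem_hibiSigma {P : Type*} [PartialOrder P] [Finite P]
    {ψ : WithBot (WithTop P) → ℝ} (hψ : ψ ∈ hibiSigma P) : Antitone ψ :=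
  antitone_of_covBy_le fun x y hxy => sub_nonneg.1 (hψ.2 x y hxy).1

theorem isCompact_hibiSigma (P : Type*) [PartialOrder P] [Finite P] :
    IsCompact (hibiSigma P) := by
  -- Descending from `⊤`, each cover adds at most one to the bound.
  have hbound : ∀ x : WithBot (WithTop P), ∃ B : ℝ, ∀ ψ ∈ hibiSigma P, ψ x ≤ B := by
    intro x
    induction x using WellFoundedGT.induction with
    | ind x ih =>
      by_cases hx : IsMax x
      · exact ⟨0, fun ψ hψ => by rw [hx.eq_top, hψ.1]⟩
      · obtain ⟨y, hxy⟩ := exists_covBy_of_wellFoundedLT hx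
        obtain ⟨B, hB⟩ := ih y hxy.lt
        exact ⟨B + 1, fun ψ hψ => by linarith [hB ψ hψ, (hψ.2 x y hxy).2]⟩
  choose B hB using hbound
  refine IsCompact.of_isClosed_subset
    (isCompact_univ_pi fun x => isCompact_Icc (a := (0 : ℝ)) (b := B x)) ?_ ?_
  · have : hibiSigma P = {ψ | ψ ⊤ = 0} ∩ ⋂ (x) (y) (_ : x ⋖ y),
        {ψ : WithBot (WithTop P) → ℝ | 0 ≤ ψ x - ψ y ∧ ψ x - ψ y ≤ 1} := by
      ext ψ; simp [hibiSigma]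
    rw [this]
    refine (isClosed_eq (continuous_apply ⊤) continuous_const).inter
      (isClosed_iInter fun x => isClosed_iInter fun y => isClosed_iInter fun _ => ?_)
    have hc : Continuous fun ψ : WithBot (WithTop P) → ℝ => ψ x - ψ y := by fun_prop
    exact (isClosed_le continuous_const hc).inter (isClosed_le hc continuous_const)
  · intro ψ hψ x _
    exact ⟨hψ.1 ▸ antitone_of_mem_hibiSigma hψ le_top, hB x ψ hψ⟩

theorem exists_mem_hibiSigma_bot_eq_one (P : Type*) [PartialOrder P] :
    ∃ ψ ∈ hibiSigma P, ψ ⊥ = 1 := by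
  classical
  refine ⟨fun x => if x = ⊥ then 1 else 0, ⟨by simp, fun x y hxy => ?_⟩, by simp⟩
  have hy : y ≠ ⊥ := hxy.lt.ne_bot
  simp only [hy, if_false]
  split_ifs <;> norm_num

variable {k : Type*} [Field k] {P : Type*} [PartialOrder P] [Fintype P]

/-- If `(R, 𝔪 ^ t)` is `F`-pure, then `t ≤ ψ(-∞)` for some `ψ ∈ Σ`. -/
theorem exists_le_of_isFPurePair {p : ℕ} [Fact p.Prime] [CharP k p] {t : ℝ}
    (h : IsFPurePair p (hibiMaxIdeal k P) t) : ∃ ψ ∈ hibiSigma P, t ≤ ψ ⊥ := by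
  obtain ⟨e, ⟨d, hd, hs⟩, he⟩ := (h.and (Filter.eventually_ge_atTop 1)).exists
  obtain ⟨v, hva, hvs, hv⟩ := exists_of_frobRootSplits hd hs
  have hq : (1 : ℝ) < (p : ℝ) ^ e :=
    one_lt_pow₀ (by exact_mod_cast (Fact.out : p.Prime).one_lt) (by omega)
  have hq0 : (0 : ℝ) < (p : ℝ) ^ e - 1 := sub_pos.2 hq
  refine ⟨fun x => hibiExt v x / ((p : ℝ) ^ e - 1), ⟨by simp, fun x y hxy => ?_⟩, ?_⟩
  · rw [← sub_div]
    have h1 : (hibiExt v y : ℝ) ≤ hibiExt v x := by exact_mod_cast hva hxy.le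
    have h2 : (hibiExt v x : ℝ) + 1 ≤ hibiExt v y + (p : ℝ) ^ e := by exact_mod_cast hv x y hxy
    exact ⟨div_nonneg (sub_nonneg.2 h1) hq0.le, (div_le_one hq0).2 (by linarith)⟩
  · rw [le_div_iff₀ hq0]
    exact (Nat.le_ceil _).trans (by exact_mod_cast hvs)

/-- If `t < ψ(-∞)` for some `ψ ∈ Σ`, then `(R, 𝔪 ^ t)` is `F`-pure. -/
theorem isFPurePair_of_lt {p : ℕ} [Fact p.Prime] [CharP k p] {t : ℝ}
    {ψ : WithBot (WithTop P) → ℝ} (hψ : ψ ∈ hibiSigma P) (ht : t < ψ ⊥) :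
    IsFPurePair p (hibiMaxIdeal k P) t := by
  have hp1 : (1 : ℝ) < p := by exact_mod_cast (Fact.out : p.Prime).one_lt
  have hanti := antitone_of_mem_hibiSigma hψ
  have hψ0 : ∀ x, 0 ≤ ψ x := fun x => hψ.1 ▸ hanti le_top
  -- This makes `(ψ ⊥ - t) (q - 1) ≥ 1`, which absorbs the rounding at `⊥`.
  have hlarge : ∀ᶠ e : ℕ in Filter.atTop, 1 / (ψ ⊥ - t) + 1 ≤ (p : ℝ) ^ e :=
    (tendsto_pow_atTop_atTop_of_one_lt hp1).eventually_ge_atTop _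
  filter_upwards [hlarge] with e he
  have hq1 : (1 : ℝ) ≤ (p : ℝ) ^ e := one_le_pow₀ hp1.le
  have hq0 : (0 : ℝ) ≤ (p : ℝ) ^ e - 1 := sub_nonneg.2 hq1
  obtain ⟨v, hv⟩ := exists_hibiExt_eq (P := P) (fun x => ⌊ψ x * ((p : ℝ) ^ e - 1)⌋₊)
    (by simp [hψ.1])
  have hva : Antitone (hibiExt v) := by
    rw [hv]
    exact fun x y hxy => Nat.floor_le_floor (mul_le_mul_of_nonneg_right (hanti hxy) hq0)
  have hvq : ∀ x y, x ⋖ y → hibiExt v x < hibiExt v y + p ^ e := by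
    intro x y hxy
    rw [hv]
    have h1 := Nat.floor_le (mul_nonneg (hψ0 x) hq0)
    have h2 := Nat.lt_floor_add_one (ψ y * ((p : ℝ) ^ e - 1))
    have h3 := mul_le_mul_of_nonneg_right (hψ.2 x y hxy).2 hq0
    have h4 : ((⌊ψ x * ((p : ℝ) ^ e - 1)⌋₊ : ℕ) : ℝ) <
        ((⌊ψ y * ((p : ℝ) ^ e - 1)⌋₊ + p ^ e : ℕ) : ℝ) := by
      push_cast
      linarith
    exact_mod_cast h4
  refine ⟨_, ?_, frobRootSplits_monomial p e hva hvq⟩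
  obtain ⟨_, hmem⟩ := exists_monomial_mem_pow (k := k) _ v hva rfl
  refine Ideal.pow_le_pow_right ?_ hmem
  rw [Nat.ceil_le, ← hibiExt_bot, hv]
  have h1 := Nat.lt_floor_add_one (ψ ⊥ * ((p : ℝ) ^ e - 1))
  have h2 : 1 ≤ (ψ ⊥ - t) * ((p : ℝ) ^ e - 1) := by
    rw [← div_le_iff₀' (sub_pos.2 ht)]
    linarith
  linarith

end Threshold

theorem theorem3p7 (p : ℕ) [Fact p.Prime] (k : Type*) [Field k] [CharP k p]
    (P : Type*) [PartialOrder P] [Fintype P] :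
    IsGreatest {c : EReal | ∃ ψ ∈ hibiSigma P, c = ((ψ ⊥ : ℝ) : EReal)}
      (fPureThreshold p (hibiMaxIdeal k P)) := by
  obtain ⟨ψ₁, hψ₁, h1⟩ := exists_mem_hibiSigma_bot_eq_one P
  obtain ⟨ψ, hψ, hmax⟩ := (isCompact_hibiSigma P).exists_isMaxOn ⟨ψ₁, hψ₁⟩
    (continuous_apply (⊥ : WithBot (WithTop P))).continuousOn
  have hmax' : ∀ χ ∈ hibiSigma P, χ ⊥ ≤ ψ ⊥ := fun χ hχ => hmax hχ
  have hpos : 0 < ψ ⊥ := lt_of_lt_of_le one_pos (h1 ▸ hmax' ψ₁ hψ₁)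
  have heq : fPureThreshold p (hibiMaxIdeal k P) = ((ψ ⊥ : ℝ) : EReal) := by
    refine le_antisymm (sSup_le ?_) (le_of_forall_lt fun c hc => ?_)
    · rintro _ ⟨t, -, ht, rfl⟩
      obtain ⟨χ, hχ, hle⟩ := exists_le_of_isFPurePair ht
      exact EReal.coe_le_coe_iff.2 (hle.trans (hmax' χ hχ))
    -- The threshold only admits `t ≥ 0`, hence the maximum with zero and the need for `0 < ψ ⊥`.
    · obtain ⟨t, ht, htψ⟩ := EReal.lt_iff_exists_real_btwn.1
        (max_lt hc (EReal.coe_lt_coe_iff.2 hpos : ((0 : ℝ) : EReal) < ψ ⊥))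
      rw [max_lt_iff] at ht
      exact ht.1.trans_le (le_sSup ⟨t, (EReal.coe_lt_coe_iff.1 ht.2).le,
        isFPurePair_of_lt hψ (EReal.coe_lt_coe_iff.1 htψ), rfl⟩)
  rw [heq]
  refine ⟨⟨ψ, hψ, rfl⟩, ?_⟩
  rintro _ ⟨χ, hχ, rfl⟩
  exact EReal.coe_le_coe_iff.2 (hmax' χ hχ)
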